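/- For an integer $m\ge 1$ let $\theta_m=(mx+y^m)\frac{\partial}{\partial x}+y\frac{\partial}{\partial y}$ on $\mathbb{C}^2$, and let $S^3=\{|x|^2+|y|^2=1\}$. At every point $p\in S^3$ the complex line $\mathbb{C}\,\theta_m(p)$ is transverse to $S^3$, so $\mathbb{C}\,\theta_m(p)\cap T_pS^3$ is a real line. These lines form a smooth $1$-dimensional distribution on $S^3$, whose integral foliation is denoted by $\mathcal{F}_m\cap S^3$ (the trace, or intersection, foliation); its leaf through $p$ is the set of all points of $S^3$ that can be joined to $p$ by a $C^1$ curve in $S^3$ tangent to this distribution. Two such foliations are called topologically equivalent if there is a homeomorphism $S^3\to S^3$ that maps each leaf of the first onto a leaf of the second. Theorem. If $m_1,m_2\ge 1$ are integers with $m_1\neq m_2$, then $\mathcal{F}_{m_1}\cap S^3$ and $\mathcal{F}_{m_2}\cap S^3$ are not topologically equivalent. -/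

import Mathlib

open scoped InnerProductSpace

/-- The unit sphere `S^{2n-1}` in `ℂⁿ` with its Hermitian norm. -/
abbrev UnitSphere (n : ℕ) : Type := Metric.sphere (0 : EuclideanSpace ℂ (Fin n)) 1

/-- The intersection of the complex line spanned by the vector field `θ` at `p` (the tangent space
of the leaf of `θ` through `p`) with the real tangent space `{v | Re ⟪p, v⟫ = 0}` at `p` of the
sphere through `p` centred at the origin. -/
def traceDistribution {n : ℕ} (θ : EuclideanSpace ℂ (Fin n) → EuclideanSpace ℂ (Fin n))
    (p : EuclideanSpace ℂ (Fin n)) : Submodule ℝ (EuclideanSpace ℂ (Fin n)) where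
  carrier := {v | (∃ c : ℂ, v = c • θ p) ∧ (⟪p, v⟫_ℂ).re = 0}
  zero_mem' := ⟨⟨0, by simp⟩, by simp⟩
  add_mem' := by
    rintro v w ⟨⟨c, hc⟩, hv⟩ ⟨⟨d, hd⟩, hw⟩
    exact ⟨⟨c + d, by rw [hc, hd, add_smul]⟩, by rw [inner_add_right, Complex.add_re, hv, hw, add_zero]⟩
  smul_mem' := by
    rintro r v ⟨⟨c, hc⟩, hv⟩
    refine ⟨⟨(r : ℂ) * c, by rw [hc, mul_smul, Complex.coe_smul]⟩, ?_⟩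
    rw [← Complex.coe_smul, inner_smul_right, Complex.re_ofReal_mul, hv, mul_zero]

/-- The leaf through `p` of the trace foliation of `θ` on the unit sphere: all points that can be
joined to `p` inside the sphere by a `C¹` curve tangent to the trace distribution. -/
def traceLeaf {n : ℕ} (θ : EuclideanSpace ℂ (Fin n) → EuclideanSpace ℂ (Fin n))
    (p : UnitSphere n) : Set (UnitSphere n) :=
  {q | ∃ γ : ℝ → EuclideanSpace ℂ (Fin n), ContDiff ℝ 1 γ ∧ (∀ t, ‖γ t‖ = 1) ∧
    (∀ t, deriv γ t ∈ traceDistribution θ (γ t)) ∧ γ 0 = p ∧ γ 1 = q}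

/-- The trace foliations of `θ` and `η` on the unit sphere are topologically equivalent: some
homeomorphism of the sphere maps each leaf of the first onto a leaf of the second. -/
def TraceFoliationsEquivalent {n : ℕ}
    (θ η : EuclideanSpace ℂ (Fin n) → EuclideanSpace ℂ (Fin n)) : Prop :=
  ∃ φ : UnitSphere n ≃ₜ UnitSphere n, ∀ p : UnitSphere n, φ '' traceLeaf θ p = traceLeaf η (φ p)

/-- The vector field `(m x + y ^ m) ∂/∂x + y ∂/∂y` on `ℂ²`, where `x = z 0` and `y = z 1`. -/
def resonantField (m : ℕ) (z : EuclideanSpace ℂ (Fin 2)) : EuclideanSpace ℂ (Fin 2) :=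
  !₂[(m : ℂ) * z 0 + z 1 ^ m, z 1]

/-- Where `θ` is transverse to the sphere, the trace distribution is the real line spanned by
`i * conj ⟪p, θ p⟫ • θ p`. -/
theorem traceDistribution_eq_span {n : ℕ}
    (θ : EuclideanSpace ℂ (Fin n) → EuclideanSpace ℂ (Fin n)) (p : EuclideanSpace ℂ (Fin n))
    (h : (⟪p, θ p⟫_ℂ) ≠ 0) :
    traceDistribution θ p =
      Submodule.span ℝ {(Complex.I * (starRingEnd ℂ) (⟪p, θ p⟫_ℂ)) • θ p} := by
  ext v
  rw [Submodule.mem_span_singleton]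
  constructor
  · rintro ⟨⟨c, rfl⟩, hv⟩
    rw [inner_smul_right] at hv
    refine ⟨(c * ⟪p, θ p⟫_ℂ).im / Complex.normSq (⟪p, θ p⟫_ℂ), ?_⟩
    rw [← Complex.coe_smul, smul_smul]
    congr 1
    have h1 : (c * ⟪p, θ p⟫_ℂ) = Complex.I * ((c * ⟪p, θ p⟫_ℂ).im : ℂ) := by
      apply Complex.ext
      · rw [hv]; simp
      · simp
    have h2 : (Complex.normSq (⟪p, θ p⟫_ℂ) : ℂ) = ⟪p, θ p⟫_ℂ * (starRingEnd ℂ) (⟪p, θ p⟫_ℂ) :=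
      (Complex.mul_conj _).symm
    have h3 : (starRingEnd ℂ) (⟪p, θ p⟫_ℂ) ≠ 0 := (map_ne_zero _).2 h
    rw [Complex.ofReal_div, h2]
    generalize hk : (((c * ⟪p, θ p⟫_ℂ).im : ℝ) : ℂ) = k at h1 ⊢
    field_simp
    rw [mul_comm k, ← h1, mul_comm]
  · rintro ⟨r, rfl⟩
    apply Submodule.smul_mem
    refine ⟨⟨_, rfl⟩, ?_⟩
    rw [inner_smul_right, mul_assoc, mul_comm ((starRingEnd ℂ) _), Complex.mul_conj]
    simp

/-- For `m ≥ 1` the resonant field is transverse to the unit sphere at each of its points, so that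
its trace distribution there is a field of real lines. -/
theorem resonantField_transverse (m : ℕ) (hm : 1 ≤ m) (p : UnitSphere 2) :
    (⟪(p : EuclideanSpace ℂ (Fin 2)), resonantField m p⟫_ℂ) ≠ 0 := by
  obtain ⟨z, hz⟩ := p
  have hn : ‖z 0‖ ^ 2 + ‖z 1‖ ^ 2 = 1 := by
    have h := EuclideanSpace.norm_sq_eq z
    rw [mem_sphere_zero_iff_norm.1 hz, Fin.sum_univ_two] at h
    linarith
  have key : (⟪z, resonantField m z⟫_ℂ) =
      ((m * ‖z 0‖ ^ 2 + ‖z 1‖ ^ 2 : ℝ) : ℂ) + z 1 ^ m * (starRingEnd ℂ) (z 0) := by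
    have h0 := Complex.mul_conj' (z 0)
    have h1 := Complex.mul_conj' (z 1)
    simp only [resonantField, PiLp.inner_apply, Fin.sum_univ_two, RCLike.inner_apply]
    push_cast
    rw [← h0, ← h1]
    simp
    ring
  intro h0
  change (⟪z, resonantField m z⟫_ℂ) = 0 at h0
  rw [key] at h0
  have h1 : ‖((m * ‖z 0‖ ^ 2 + ‖z 1‖ ^ 2 : ℝ) : ℂ)‖ = ‖z 1‖ ^ m * ‖z 0‖ := by
    rw [eq_neg_of_add_eq_zero_left h0]
    simp
  rw [Complex.norm_of_nonneg (by positivity)] at h1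
  have hm' : (1 : ℝ) ≤ m := by exact_mod_cast hm
  have hy : ‖z 1‖ ≤ 1 := by nlinarith [norm_nonneg (z 1), sq_nonneg ‖z 0‖]
  have hp : ‖z 1‖ ^ m ≤ ‖z 1‖ := pow_le_of_le_one (norm_nonneg _) hy (by omega)
  nlinarith [norm_nonneg (z 0), norm_nonneg (z 1), sq_nonneg (‖z 0‖ - ‖z 1‖),
    mul_le_mul_of_nonneg_right hp (norm_nonneg (z 0)),
    mul_nonneg (sub_nonneg.2 hm') (sq_nonneg ‖z 0‖)]

/-! Each leaf lies in one orbit of the complex flow `(e^{mT}(x + T y^m), y e^T)` and meets every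
imaginary time. The circle `y = 0` is the only closed leaf (`isClosed_traceLeaf_of_eq_zero`,
`not_isClosed_traceLeaf_of_ne_zero`), so an equivalence `φ` preserves it and acts on it with some
degree `d`.

The integer `m` is visible in the way nearby leaves sit around this circle. Off it, the real part
`leafHeight` of the multivalued first integral `x / y^m - log y` is constant on leaves. Leaves of
large height stay near the circle, and a leaf that stays near it has nonzero height
(`leafHeight_ne_zero`), which keeps `x / y^m` off a half-line issuing from 0. Hence a loop through
such leaves winds `m` times as often in `x` as in `y` (`hasWinding_of_leafHeight_ne_zero`).

Take a loop running `m₁` times along the circle, close to it and inside leaves of large height. The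
winding of its `φ`-image in `x` is `m₁ d` by closeness and a multiple of `m₂` by the above, so `m₂ ∣
m₁ d` (`dvd_mul_degree`). As `d = ±1`, `m₂ ∣ m₁`; the inverse of `φ` gives the converse. -/

/-! ### Winding numbers through continuous logarithms -/

/-- The `2π`-periodic loop `f` in `ℂ \ {0}` winds `n` times around the origin. -/
def HasWinding (f : ℝ → ℂ) (n : ℤ) : Prop :=
  ∃ g : ℝ → ℂ, Continuous g ∧ (∀ t, f t = Complex.exp (g t)) ∧
    ∀ t, g (t + 2 * Real.pi) = g t + 2 * Real.pi * Complex.I * n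

/-- A continuous function on the line with values in `2πiℤ` is constant. -/
theorem exists_int_eq_of_exp_eq_one {h : ℝ → ℂ} (hc : Continuous h)
    (h1 : ∀ t, Complex.exp (h t) = 1) :
    ∃ n : ℤ, ∀ t, h t = 2 * Real.pi * Complex.I * n := by
  have key : ∀ t, ∃ n : ℤ, h t = n * (2 * Real.pi * Complex.I) :=
    fun t => Complex.exp_eq_one_iff.1 (h1 t)
  obtain ⟨n, hn⟩ := key 0
  refine ⟨n, fun t => ?_⟩
  -- Both `h` and the constant `h 0` lift the constant path 1 through `exp` from the same point, so
  -- they agree.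
  obtain ⟨F, -, hF⟩ := Complex.isCoveringMapOn_exp.existsUnique_continuousMap_lifts
    (⟨fun _ => 1, continuous_const⟩ : C(ℝ, ℂ)) (a₀ := 0) (e₀ := h 0) (h1 0) (fun _ => one_ne_zero)
  have e1 := hF ⟨h, hc⟩ ⟨rfl, funext h1⟩
  have e2 := hF ⟨fun _ => h 0, continuous_const⟩ ⟨rfl, funext fun _ => h1 0⟩
  have e3 := congrArg (fun G : C(ℝ, ℂ) => G t) (e1.trans e2.symm)
  change h t = h 0 at e3
  rw [e3, hn, mul_comm]

theorem exists_continuous_log {f : ℝ → ℂ} (hf : Continuous f) (h0 : ∀ t, f t ≠ 0) :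
    ∃ g : ℝ → ℂ, Continuous g ∧ ∀ t, f t = Complex.exp (g t) := by
  obtain ⟨F, ⟨-, hF⟩, -⟩ := Complex.isCoveringMapOn_exp.existsUnique_continuousMap_lifts
    (⟨f, hf⟩ : C(ℝ, ℂ)) (a₀ := 0) (e₀ := Complex.log (f 0)) (Complex.exp_log (h0 0)) h0
  exact ⟨F, F.continuous, fun t => (congrFun hF t).symm⟩

theorem exists_hasWinding {f : ℝ → ℂ} (hf : Continuous f) (h0 : ∀ t, f t ≠ 0)
    (hp : ∀ t, f (t + 2 * Real.pi) = f t) : ∃ n, HasWinding f n := by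
  obtain ⟨g, hg, hfg⟩ := exists_continuous_log hf h0
  obtain ⟨n, hn⟩ := exists_int_eq_of_exp_eq_one (h := fun t => g (t + 2 * Real.pi) - g t)
    (by fun_prop) (fun t => by
      rw [Complex.exp_sub, ← hfg, ← hfg, hp, div_self (h0 t)])
  exact ⟨n, g, hg, hfg, fun t => by rw [← hn t]; ring⟩

theorem HasWinding.unique {f : ℝ → ℂ} {a b : ℤ} (ha : HasWinding f a) (hb : HasWinding f b) :
    a = b := by
  obtain ⟨g, hg, hfg, hga⟩ := ha
  obtain ⟨k, hk, hfk, hkb⟩ := hb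
  obtain ⟨n, hn⟩ := exists_int_eq_of_exp_eq_one (h := fun t => g t - k t)
    (by fun_prop) (fun t => by
      rw [Complex.exp_sub, ← hfg, ← hfk, div_self (by rw [hfg]; exact Complex.exp_ne_zero _)])
  have h1 := hn 0
  have h2 := hn (0 + 2 * Real.pi)
  simp only [hga, hkb] at h2
  have h3 : (2 * Real.pi * Complex.I) * ((a : ℂ) - b) = 0 := by linear_combination h2 - h1
  have h4 := (mul_eq_zero.1 h3).resolve_left Complex.two_pi_I_ne_zero
  exact_mod_cast sub_eq_zero.1 h4

theorem HasWinding.mul {f g : ℝ → ℂ} {a b : ℤ} (ha : HasWinding f a) (hb : HasWinding g b) :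
    HasWinding (fun t => f t * g t) (a + b) := by
  obtain ⟨u, hu, hfu, hua⟩ := ha
  obtain ⟨v, hv, hgv, hvb⟩ := hb
  refine ⟨fun t => u t + v t, by fun_prop, fun t => by
    beta_reduce; rw [Complex.exp_add, hfu, hgv], fun t => ?_⟩
  simp only [hua, hvb]
  push_cast
  ring

theorem HasWinding.pow {f : ℝ → ℂ} {a : ℤ} (ha : HasWinding f a) (m : ℕ) :
    HasWinding (fun t => f t ^ m) (m * a) := by
  obtain ⟨u, hu, hfu, hua⟩ := ha
  refine ⟨fun t => m * u t, by fun_prop, fun t => by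
    beta_reduce; rw [Complex.exp_nat_mul, hfu], fun t => ?_⟩
  simp only [hua]
  push_cast
  ring

theorem hasWinding_zero_of_mem_slitPlane {f : ℝ → ℂ} (hf : Continuous f)
    (hp : ∀ t, f (t + 2 * Real.pi) = f t) (hs : ∀ t, f t ∈ Complex.slitPlane) :
    HasWinding f 0 :=
  ⟨fun t => Complex.log (f t), hf.clog hs,
    fun t => (Complex.exp_log (Complex.slitPlane_ne_zero (hs t))).symm, fun t => by simp [hp t]⟩

theorem hasWinding_zero_of_neg_mem_slitPlane {f : ℝ → ℂ} (hf : Continuous f)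
    (hp : ∀ t, f (t + 2 * Real.pi) = f t) (hs : ∀ t, -f t ∈ Complex.slitPlane) :
    HasWinding f 0 :=
  ⟨fun t => Complex.log (-f t) + Real.pi * Complex.I, (hf.neg.clog hs).add continuous_const,
    fun t => by
      rw [Complex.exp_add, Complex.exp_log (Complex.slitPlane_ne_zero (hs t)), Complex.exp_pi_mul_I]
      ring, fun t => by simp [hp t]⟩

/-- The Rouché argument: `f / g` stays in the unit disc about 1, where the principal logarithm is
continuous, so it has winding 0. -/
theorem HasWinding.of_norm_sub_lt {f g : ℝ → ℂ} {n : ℤ} (hg : HasWinding g n) (hf : Continuous f)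
    (hp : ∀ t, f (t + 2 * Real.pi) = f t) (h : ∀ t, ‖f t - g t‖ < ‖g t‖) : HasWinding f n := by
  obtain ⟨u, hu, hgu, hun⟩ := hg
  have hgc : Continuous g := (continuous_congr hgu).2 (by fun_prop)
  have hg0 : ∀ t, g t ≠ 0 := fun t => by rw [hgu]; exact Complex.exp_ne_zero _
  have hgp : ∀ t, g (t + 2 * Real.pi) = g t := fun t => by
    rw [hgu, hgu, hun, Complex.exp_add, mul_comm (2 * _ * _), Complex.exp_int_mul_two_pi_mul_I,
      mul_one]
  have hq : HasWinding (fun t => f t / g t) 0 := by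
    refine hasWinding_zero_of_mem_slitPlane (hf.div hgc hg0) (fun t => by simp only [hp, hgp])
      fun t => Complex.ball_one_subset_slitPlane ?_
    rw [mem_ball_iff_norm, div_sub_one (hg0 t), norm_div, div_lt_one (norm_pos_iff.2 (hg0 t))]
    exact h t
  have := hq.mul ⟨u, hu, hgu, hun⟩
  rw [zero_add] at this
  simpa only [div_mul_cancel₀ _ (hg0 _)] using this

/-- Mutually inverse self-maps of the circle have mutually inverse degrees. -/
theorem HasWinding.mul_eq_one {a b : Circle → Circle} (hab : ∀ z, b (a z) = z) {d e : ℤ}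
    (ha : HasWinding (fun t => a (Circle.exp t)) d)
    (hb : HasWinding (fun t => b (Circle.exp t)) e) : d * e = 1 := by
  obtain ⟨u, hu, hau, hud⟩ := ha
  obtain ⟨v, hv, hbv, hve⟩ := hb
  beta_reduce at hau hbv
  have hure : ∀ t, u t = (u t).im * Complex.I := fun t => by
    have h1 : ‖(a (Circle.exp t) : ℂ)‖ = 1 := Circle.norm_coe _
    rw [hau, Complex.norm_exp, Real.exp_eq_one_iff] at h1
    apply Complex.ext <;> simp [h1]
  have hae : ∀ t, a (Circle.exp t) = Circle.exp (u t).im := fun t => by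
    apply Circle.ext
    rw [hau, Circle.coe_exp, ← hure]
  -- With `Im u` and `v` as angular lifts of `a` and `b`, the composite lifts the identity up to a
  -- constant; comparing its values at 0 and 2π gives `d e = 1`.
  obtain ⟨n, hn⟩ := exists_int_eq_of_exp_eq_one (h := fun t => v (u t).im - t * Complex.I)
    (by fun_prop) (fun t => by
      rw [Complex.exp_sub, ← hbv, ← hae, hab, Circle.coe_exp, div_self (Complex.exp_ne_zero _)])
  have hvk : ∀ (k : ℤ) (s : ℝ), v (s + k * (2 * Real.pi)) = v s + 2 * Real.pi * Complex.I * e * k := by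
    have hnat : ∀ (k : ℕ) (s : ℝ),
        v (s + k * (2 * Real.pi)) = v s + 2 * Real.pi * Complex.I * e * k := by
      intro k
      induction k with
      | zero => simp
      | succ k ih =>
        intro s
        have : s + ((k + 1 : ℕ) : ℝ) * (2 * Real.pi) = (s + k * (2 * Real.pi)) + 2 * Real.pi := by
          push_cast; ring
        rw [this, hve, ih]
        push_cast
        ring
    intro k s
    obtain ⟨k, rfl | rfl⟩ := k.eq_nat_or_neg
    · exact_mod_cast hnat k s
    · have := hnat k (s + ((-k : ℤ) : ℝ) * (2 * Real.pi))
      have h2 : s + ((-k : ℤ) : ℝ) * (2 * Real.pi) + k * (2 * Real.pi) = s := by push_cast; ring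
      rw [h2] at this
      rw [this]
      push_cast
      ring
  have h0 := hn 0
  have h1 := hn (0 + 2 * Real.pi)
  have him : (u (0 + 2 * Real.pi)).im = (u 0).im + d * (2 * Real.pi) := by
    rw [hud]; simp; ring
  simp only [him, hvk] at h1
  have h3 : (2 * Real.pi * Complex.I) * ((d : ℂ) * e - 1) = 0 := by
    push_cast at h0 h1
    linear_combination h1 - h0
  have h4 := (mul_eq_zero.1 h3).resolve_left Complex.two_pi_I_ne_zero
  exact_mod_cast sub_eq_zero.1 h4

/-! ### The complex flow and its transversality to the sphere -/

/-- The complex flow of `resonantField m`. -/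
noncomputable def resonantFlow (m : ℕ) (p : EuclideanSpace ℂ (Fin 2)) (T : ℂ) : EuclideanSpace ℂ (Fin 2) :=
  !₂[Complex.exp (m * T) * (p 0 + T * p 1 ^ m), p 1 * Complex.exp T]

@[simp] theorem resonantFlow_apply_zero (m : ℕ) (p : EuclideanSpace ℂ (Fin 2)) (T : ℂ) :
    resonantFlow m p T 0 = Complex.exp (m * T) * (p 0 + T * p 1 ^ m) := rfl

@[simp] theorem resonantFlow_apply_one (m : ℕ) (p : EuclideanSpace ℂ (Fin 2)) (T : ℂ) :
    resonantFlow m p T 1 = p 1 * Complex.exp T := rfl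

@[simp] theorem resonantField_apply_zero (m : ℕ) (p : EuclideanSpace ℂ (Fin 2)) :
    resonantField m p 0 = m * p 0 + p 1 ^ m := rfl

@[simp] theorem resonantField_apply_one (m : ℕ) (p : EuclideanSpace ℂ (Fin 2)) :
    resonantField m p 1 = p 1 := rfl

theorem norm_sq_eq_add (w : EuclideanSpace ℂ (Fin 2)) : ‖w‖ ^ 2 = ‖w 0‖ ^ 2 + ‖w 1‖ ^ 2 := by
  rw [EuclideanSpace.norm_sq_eq, Fin.sum_univ_two]

theorem hasDerivAt_resonantFlow_zero (m : ℕ) (p : EuclideanSpace ℂ (Fin 2)) (T : ℂ) :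
    HasDerivAt (fun T => resonantFlow m p T 0) (resonantField m (resonantFlow m p T) 0) T := by
  have h1 : HasDerivAt (fun T : ℂ => Complex.exp (m * T)) (Complex.exp (m * T) * (m * 1)) T :=
    ((hasDerivAt_id T).const_mul (m : ℂ)).cexp
  have h2 : HasDerivAt (fun T : ℂ => p 0 + T * p 1 ^ m) (1 * p 1 ^ m) T :=
    ((hasDerivAt_id T).mul_const _).const_add _
  refine (h1.mul h2).congr_deriv ?_
  simp only [resonantField_apply_zero, resonantFlow_apply_zero, resonantFlow_apply_one, mul_pow,
    ← Complex.exp_nat_mul]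
  ring

theorem hasDerivAt_resonantFlow_one (m : ℕ) (p : EuclideanSpace ℂ (Fin 2)) (T : ℂ) :
    HasDerivAt (fun T => resonantFlow m p T 1) (resonantField m (resonantFlow m p T) 1) T :=
  (Complex.hasDerivAt_exp T).const_mul (p 1)

theorem hasDerivAt_resonantFlow (m : ℕ) (p : EuclideanSpace ℂ (Fin 2)) (T : ℂ) :
    HasDerivAt (resonantFlow m p) (resonantField m (resonantFlow m p T)) T := by
  have h : HasDerivAt (fun T => (resonantFlow m p T).ofLp)
      (resonantField m (resonantFlow m p T)).ofLp T := by
    rw [hasDerivAt_pi]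
    intro i
    fin_cases i
    · exact hasDerivAt_resonantFlow_zero m p T
    · exact hasDerivAt_resonantFlow_one m p T
  exact (PiLp.hasFDerivAt_toLp (𝕜 := ℂ) 2 _).comp_hasDerivAt T h

theorem contDiff_resonantFlow (m : ℕ) (p : EuclideanSpace ℂ (Fin 2)) :
    ContDiff ℝ 1 (resonantFlow m p) := by
  have : ContDiff ℂ 1 (resonantFlow m p) := by
    rw [contDiff_euclidean]
    intro i
    fin_cases i
    · change ContDiff ℂ 1 fun T => Complex.exp (m * T) * (p 0 + T * p 1 ^ m)
      fun_prop
    · change ContDiff ℂ 1 fun T => p 1 * Complex.exp T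
      fun_prop
  exact this.restrict_scalars ℝ

theorem resonantFlow_ne_zero {m : ℕ} (hm : 1 ≤ m) {p : EuclideanSpace ℂ (Fin 2)} (hp : p ≠ 0)
    (T : ℂ) : resonantFlow m p T ≠ 0 := by
  intro h
  apply hp
  have h1 : p 1 * Complex.exp T = 0 := congrArg (fun w : EuclideanSpace ℂ (Fin 2) => w 1) h
  have h0 : Complex.exp (m * T) * (p 0 + T * p 1 ^ m) = 0 :=
    congrArg (fun w : EuclideanSpace ℂ (Fin 2) => w 0) h
  have hy : p 1 = 0 := (mul_eq_zero.1 h1).resolve_right (Complex.exp_ne_zero _)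
  rw [hy] at h0
  have h0' := (mul_eq_zero.1 h0).resolve_left (Complex.exp_ne_zero _)
  have hx : p 0 = 0 := by simpa [Nat.one_le_iff_ne_zero.1 hm] using h0'
  ext i
  fin_cases i
  · exact hx
  · exact hy

/-- Inside the closed unit ball the resonant field points away from the origin. -/
theorem inner_resonantField_pos {m : ℕ} (hm : 1 ≤ m) {w : EuclideanSpace ℂ (Fin 2)} (h0 : w ≠ 0)
    (h1 : ‖w‖ ≤ 1) :
    0 < inner ℝ (w 0) (resonantField m w 0) + inner ℝ (w 1) (resonantField m w 1) := by
  have hn := norm_sq_eq_add w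
  have hpos : 0 < ‖w‖ := norm_pos_iff.2 h0
  have hm' : (1 : ℝ) ≤ m := by exact_mod_cast hm
  have hy : ‖w 1‖ ≤ 1 := by nlinarith [norm_nonneg (w 1), sq_nonneg ‖w 0‖]
  have hpw : ‖w 1‖ ^ m ≤ ‖w 1‖ := pow_le_of_le_one (norm_nonneg _) hy (by omega)
  have e1 : inner ℝ (w 0) ((m : ℂ) * w 0) = m * ‖w 0‖ ^ 2 := by
    have : (m : ℂ) * w 0 = (m : ℝ) • w 0 := by simp
    rw [this, real_inner_smul_right, real_inner_self_eq_norm_sq]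
  have e2 := (abs_le.1 (abs_real_inner_le_norm (w 0) (w 1 ^ m))).1
  rw [norm_pow] at e2
  rw [resonantField_apply_zero, resonantField_apply_one, inner_add_right, e1,
    real_inner_self_eq_norm_sq]
  -- The resonant term costs at most `‖w 0‖ ‖w 1‖`, which the positive definite form `a² - ab + b²`
  -- absorbs.
  have e3 : ‖w 0‖ * ‖w 1‖ ^ m ≤ ‖w 0‖ * ‖w 1‖ := mul_le_mul_of_nonneg_left hpw (norm_nonneg _)
  nlinarith [sq_nonneg (‖w 0‖ - ‖w 1‖), mul_nonneg (sub_nonneg.2 hm') (sq_nonneg ‖w 0‖)]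

/-! ### Leaves as graphs over imaginary time -/

/-- The squared norm of the point of the flow line of `p` at time `s + i τ`. -/
noncomputable def flowNormSq (m : ℕ) (p : EuclideanSpace ℂ (Fin 2)) (u : ℝ × ℝ) : ℝ :=
  ‖resonantFlow m p (u.2 + u.1 * Complex.I)‖ ^ 2

theorem contDiff_flowNormSq (m : ℕ) (p : EuclideanSpace ℂ (Fin 2)) :
    ContDiff ℝ 1 (flowNormSq m p) := by
  have h1 : ContDiff ℝ 1 (fun u : ℝ × ℝ => (u.2 + u.1 * Complex.I : ℂ)) :=
    (Complex.ofRealCLM.contDiff.comp contDiff_snd).add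
      ((Complex.ofRealCLM.contDiff.comp contDiff_fst).mul contDiff_const)
  exact ContDiff.norm_sq ℂ ((contDiff_resonantFlow m p).comp h1)

theorem hasDerivAt_flowNormSq (m : ℕ) (p : EuclideanSpace ℂ (Fin 2)) (τ s : ℝ) :
    HasDerivAt (fun s => flowNormSq m p (τ, s))
      (2 * (inner ℝ (resonantFlow m p (s + τ * Complex.I) 0)
          (resonantField m (resonantFlow m p (s + τ * Complex.I)) 0) +
        inner ℝ (resonantFlow m p (s + τ * Complex.I) 1)
          (resonantField m (resonantFlow m p (s + τ * Complex.I)) 1))) s := by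
  have ht : HasDerivAt (fun s : ℝ => (s + τ * Complex.I : ℂ)) 1 s :=
    (Complex.ofRealCLM.hasDerivAt (x := s)).add_const _
  have h0 := ((hasDerivAt_resonantFlow_zero m p (s + τ * Complex.I)).scomp s ht).norm_sq
  have h1 := ((hasDerivAt_resonantFlow_one m p (s + τ * Complex.I)).scomp s ht).norm_sq
  refine ((h0.add h1).congr_deriv ?_).congr_of_eventuallyEq (Filter.Eventually.of_forall fun r => ?_)
  · simp only [one_smul, Function.comp_apply]
    ring
  · exact norm_sq_eq_add _

theorem deriv_flowNormSq_pos {m : ℕ} (hm : 1 ≤ m) {p : EuclideanSpace ℂ (Fin 2)} (hp : p ≠ 0)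
    {τ s : ℝ} (h : flowNormSq m p (τ, s) ≤ 1) :
    0 < deriv (fun s => flowNormSq m p (τ, s)) s := by
  rw [(hasDerivAt_flowNormSq m p τ s).deriv]
  refine mul_pos two_pos (inner_resonantField_pos hm (resonantFlow_ne_zero hm hp _) ?_)
  exact (sq_le_one_iff₀ (norm_nonneg _)).1 h

/-- The norm increases in real time wherever it is at most 1. Run backwards from a crossing, it
therefore cannot rise above 1 again, so it is strictly monotone up to the crossing. -/
theorem flowNormSq_lt_one {m : ℕ} (hm : 1 ≤ m) {p : EuclideanSpace ℂ (Fin 2)} (hp : p ≠ 0)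
    {τ s s' : ℝ} (h : flowNormSq m p (τ, s) = 1) (hs : s' < s) : flowNormSq m p (τ, s') < 1 := by
  have hd : ∀ r, HasDerivAt (fun s => flowNormSq m p (τ, s))
      (deriv (fun s => flowNormSq m p (τ, s)) r) r :=
    fun r => (hasDerivAt_flowNormSq m p τ r).differentiableAt.hasDerivAt
  have hd' : ∀ r, HasDerivAt (fun r => flowNormSq m p (τ, -r))
      (-deriv (fun s => flowNormSq m p (τ, s)) (-r)) r := fun r =>
    ((hd (-r)).scomp r (hasDerivAt_neg r)).congr_deriv (neg_one_smul _ _)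
  have hle : ∀ r ≤ s, flowNormSq m p (τ, r) ≤ 1 := fun r hr => by
    have := image_le_of_deriv_right_lt_deriv_boundary (f := fun r => flowNormSq m p (τ, -r))
      (a := -s) (b := -r) (B := fun _ => 1) (B' := fun _ => 0)
      (fun x _ => (hd' x).continuousAt.continuousWithinAt)
      (fun x _ => (hd' x).hasDerivWithinAt) (by simp [h]) (fun x => hasDerivAt_const x 1)
      (fun x _ hx => neg_lt_zero.2 (deriv_flowNormSq_pos hm hp hx.le))
      (Set.mem_Icc.2 ⟨neg_le_neg hr, le_rfl⟩)
    simpa using this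
  have hmono := strictMonoOn_of_deriv_pos (convex_Iic s)
    (f := fun s => flowNormSq m p (τ, s)) (fun x _ => (hd x).continuousAt.continuousWithinAt)
    (fun x hx => deriv_flowNormSq_pos hm hp (hle x (Set.mem_Iic.1 (interior_subset hx))))
  have := hmono (Set.mem_Iic.2 hs.le) (Set.mem_Iic.2 le_rfl) hs
  simpa [h] using this

theorem flowNormSq_eq_one_unique {m : ℕ} (hm : 1 ≤ m) {p : EuclideanSpace ℂ (Fin 2)} (hp : p ≠ 0)
    {τ s s' : ℝ} (h : flowNormSq m p (τ, s) = 1) (h' : flowNormSq m p (τ, s') = 1) : s = s' := by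
  rcases lt_trichotomy s s' with hs | hs | hs
  · exact absurd h (flowNormSq_lt_one hm hp h' hs).ne
  · exact hs
  · exact absurd h' (flowNormSq_lt_one hm hp h hs).ne

theorem norm_exp_ofReal_add_mul_I (s τ : ℝ) :
    ‖Complex.exp (s + τ * Complex.I)‖ = Real.exp s := by
  simp [Complex.norm_exp]

theorem norm_exp_nat_mul_ofReal_add_mul_I (m : ℕ) (s τ : ℝ) :
    ‖Complex.exp (m * (s + τ * Complex.I))‖ = Real.exp s ^ m := by
  rw [Complex.exp_nat_mul, norm_pow, norm_exp_ofReal_add_mul_I]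

theorem exists_flowNormSq_eq_one {m : ℕ} (hm : 1 ≤ m) {p : EuclideanSpace ℂ (Fin 2)}
    (hp : ‖p‖ = 1) (τ : ℝ) : ∃ s, flowNormSq m p (τ, s) = 1 := by
  have hn := norm_sq_eq_add p
  rw [hp] at hn
  have hx : ‖p 0‖ ≤ 1 := by nlinarith [norm_nonneg (p 0), sq_nonneg ‖p 1‖]
  have hy : ‖p 1‖ ≤ 1 := by nlinarith [norm_nonneg (p 1), sq_nonneg ‖p 0‖]
  have hsplit : ∀ s : ℝ, flowNormSq m p (τ, s) =
      (Real.exp s ^ m * ‖p 0 + (s + τ * Complex.I) * p 1 ^ m‖) ^ 2 +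
        (‖p 1‖ * Real.exp s) ^ 2 := fun s => by
    simp only [flowNormSq]
    rw [norm_sq_eq_add, resonantFlow_apply_zero, resonantFlow_apply_one, norm_mul, norm_mul,
      norm_exp_ofReal_add_mul_I, norm_exp_nat_mul_ofReal_add_mul_I]
  have hcont : Continuous fun s => flowNormSq m p (τ, s) :=
    (contDiff_flowNormSq m p).continuous.comp (by fun_prop)
  refine mem_range_of_exists_le_of_exists_ge hcont ?_ ?_
  · have t1 : Filter.Tendsto (fun r : ℝ => r * Real.exp (-r)) Filter.atTop (nhds 0) := by
      simpa using Real.tendsto_pow_mul_exp_neg_atTop_nhds_zero 1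
    have t2 : Filter.Tendsto (fun r : ℝ => Real.exp (-r)) Filter.atTop (nhds 0) :=
      Real.tendsto_exp_neg_atTop_nhds_zero
    have t3 : Filter.Tendsto (fun r : ℝ => (1 + |τ|) * Real.exp (-r) + r * Real.exp (-r))
        Filter.atTop (nhds 0) := by simpa using (t2.const_mul (1 + |τ|)).add t1
    -- With `(1 + |τ| + r) e^{-r} < 1/2`, both coordinates at real time `-r` have norm at most 1/2.
    obtain ⟨r, hr1, hr2⟩ := ((t3.eventually (gt_mem_nhds (show (0 : ℝ) < 1 / 2 by norm_num))).and
      (Filter.eventually_ge_atTop 0)).exists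
    have he : 0 < Real.exp (-r) := Real.exp_pos _
    have he1 : Real.exp (-r) ≤ 1 := Real.exp_le_one_iff.2 (by linarith)
    refine ⟨-r, ?_⟩
    rw [hsplit]
    have b1 : ‖p 0 + ((-r : ℝ) + τ * Complex.I) * p 1 ^ m‖ ≤ 1 + |τ| + r := by
      have c1 : ‖p 1 ^ m‖ ≤ 1 := by rw [norm_pow]; exact pow_le_one₀ (norm_nonneg _) hy
      have c2 : ‖((-r : ℝ) + τ * Complex.I : ℂ)‖ ≤ r + |τ| := by
        refine (norm_add_le _ _).trans_eq ?_
        rw [norm_mul, Complex.norm_I, Complex.norm_real, Complex.norm_real, mul_one,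
          Real.norm_eq_abs, Real.norm_eq_abs, abs_neg, abs_of_nonneg hr2]
      calc _ ≤ ‖p 0‖ + ‖((-r : ℝ) + τ * Complex.I : ℂ)‖ * ‖p 1 ^ m‖ := by
            rw [← norm_mul]; exact norm_add_le _ _
        _ ≤ 1 + (r + |τ|) * 1 := by gcongr
        _ = _ := by ring
    have b2 : Real.exp (-r) ^ m ≤ Real.exp (-r) := pow_le_of_le_one he.le he1 (by omega)
    have b3 : Real.exp (-r) ^ m * ‖p 0 + ((-r : ℝ) + τ * Complex.I) * p 1 ^ m‖ ≤ 1 / 2 :=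
      calc _ ≤ Real.exp (-r) * (1 + |τ| + r) := by gcongr
        _ ≤ 1 / 2 := by linarith
    have b4 : ‖p 1‖ * Real.exp (-r) ≤ 1 / 2 := by
      have : 0 ≤ |τ| * Real.exp (-r) := by positivity
      have : 0 ≤ r * Real.exp (-r) := by positivity
      nlinarith
    have b5 : 0 ≤ Real.exp (-r) ^ m * ‖p 0 + ((-r : ℝ) + τ * Complex.I) * p 1 ^ m‖ := by positivity
    have b6 : 0 ≤ ‖p 1‖ * Real.exp (-r) := by positivity
    nlinarith
  · by_cases h0 : p 1 = 0
    · refine ⟨0, ?_⟩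
      rw [hsplit, h0]
      rw [h0] at hn
      have : m ≠ 0 := by omega
      simp [this] at hn ⊢
      nlinarith [norm_nonneg (p 0)]
    · have hpos : 0 < ‖p 1‖ := norm_pos_iff.2 h0
      -- At this real time the second coordinate alone has norm 1.
      refine ⟨Real.log (1 / ‖p 1‖), ?_⟩
      rw [hsplit, Real.exp_log (by positivity), mul_one_div_cancel hpos.ne']
      nlinarith [sq_nonneg ((1 / ‖p 1‖) ^ m *
        ‖p 0 + (Real.log (1 / ‖p 1‖) + τ * Complex.I) * p 1 ^ m‖)]

/-- The intersection of a flow line with the unit sphere is a graph over the imaginary time. -/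
theorem exists_contDiff_norm_resonantFlow_eq_one {m : ℕ} (hm : 1 ≤ m)
    {p : EuclideanSpace ℂ (Fin 2)} (hp : ‖p‖ = 1) :
    ∃ s : ℝ → ℝ, ContDiff ℝ 1 s ∧ s 0 = 0 ∧
      ∀ τ : ℝ, ‖resonantFlow m p (s τ + τ * Complex.I)‖ = 1 := by
  have hp0 : p ≠ 0 := by rintro rfl; simp at hp
  choose s hs using exists_flowNormSq_eq_one hm hp
  refine ⟨s, ?_, ?_, fun τ => ?_⟩
  · rw [contDiff_iff_contDiffAt]
    intro τ
    have cdf : ContDiffAt ℝ 1 (flowNormSq m p) (τ, s τ) := (contDiff_flowNormSq m p).contDiffAt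
    have hval : (fderiv ℝ (flowNormSq m p) (τ, s τ) ∘L .inr ℝ ℝ ℝ) 1 =
        deriv (fun s => flowNormSq m p (τ, s)) (s τ) := by
      have h1 : HasDerivAt (fun r : ℝ => (τ, r)) ((0 : ℝ), (1 : ℝ)) (s τ) :=
        (hasDerivAt_const _ τ).prodMk (hasDerivAt_id _)
      have h2 := (cdf.differentiableAt one_ne_zero).hasFDerivAt.comp_hasDerivAt (s τ) h1
      exact h2.deriv.symm
    have hne : (fderiv ℝ (flowNormSq m p) (τ, s τ) ∘L .inr ℝ ℝ ℝ) 1 ≠ 0 := by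
      rw [hval]; exact (deriv_flowNormSq_pos hm hp0 (hs τ).le).ne'
    have hinv : (fderiv ℝ (flowNormSq m p) (τ, s τ) ∘L .inr ℝ ℝ ℝ).IsInvertible := by
      refine ⟨ContinuousLinearEquiv.unitsEquivAut ℝ (Units.mk0 _ hne), ?_⟩
      ext
      simp
    refine (cdf.contDiffAt_implicitFunction one_ne_zero hinv).congr_of_eventuallyEq ?_
    -- The chosen crossing time agrees with the smooth implicit function because the crossing is
    -- unique.
    filter_upwards [cdf.eventually_apply_implicitFunction one_ne_zero hinv] with τ' h
    exact flowNormSq_eq_one_unique hm hp0 (hs τ') (h.trans (hs τ))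
  · refine flowNormSq_eq_one_unique hm hp0 (hs 0) ?_
    simp [flowNormSq, norm_sq_eq_add (resonantFlow _ _ _), ← norm_sq_eq_add p, hp]
  · exact (pow_eq_one_iff_of_nonneg (norm_nonneg _) two_ne_zero).1 (hs τ)

/-- Every leaf contains points of its flow line at every imaginary time. -/
theorem exists_mem_traceLeaf_eq_resonantFlow {m : ℕ} (hm : 1 ≤ m) (p : UnitSphere 2) (b : ℝ) :
    ∃ s : ℝ, ∃ q ∈ traceLeaf (resonantField m) p,
      (q : EuclideanSpace ℂ (Fin 2)) = resonantFlow m p (s + b * Complex.I) := by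
  have hp : ‖(p : EuclideanSpace ℂ (Fin 2))‖ = 1 := mem_sphere_zero_iff_norm.1 p.2
  obtain ⟨s, hs, hs0, hn⟩ := exists_contDiff_norm_resonantFlow_eq_one hm hp
  let S : ℝ → ℂ := fun t => s (b * t) + (b * t : ℝ) * Complex.I
  have hS : ContDiff ℝ 1 S := by
    have h1 : ContDiff ℝ 1 fun t : ℝ => b * t := contDiff_const.mul contDiff_id
    exact (Complex.ofRealCLM.contDiff.comp (hs.comp h1)).add
      ((Complex.ofRealCLM.contDiff.comp h1).mul contDiff_const)
  have hγ : ContDiff ℝ 1 (fun t => resonantFlow m p (S t)) := (contDiff_resonantFlow m p).comp hS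
  refine ⟨s b, ⟨resonantFlow m p (s b + b * Complex.I), mem_sphere_zero_iff_norm.2 (hn b)⟩,
    ⟨fun t => resonantFlow m p (S t), hγ, fun t => hn (b * t), fun t => ⟨?_, ?_⟩, ?_, ?_⟩, rfl⟩
  · have h1 : HasDerivAt S (deriv S t) t := (hS.differentiable one_ne_zero t).hasDerivAt
    exact ⟨deriv S t, ((hasDerivAt_resonantFlow m p (S t)).scomp t h1).deriv⟩
  · have h1 := (hγ.differentiable one_ne_zero t).hasDerivAt
    have h2 := HasDerivAt.inner ℂ h1 h1
    have h3 : (fun t => ⟪resonantFlow m p (S t), resonantFlow m p (S t)⟫_ℂ) = fun _ => 1 := by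
      funext r
      rw [inner_self_eq_norm_sq_to_K, hn (b * r)]
      simp
    rw [h3] at h2
    have h4 := congrArg Complex.re (h2.unique (hasDerivAt_const t 1))
    rw [Complex.add_re, ← inner_conj_symm (deriv _ t), Complex.conj_re] at h4
    simp only [Complex.zero_re] at h4
    linarith
  · ext i
    fin_cases i <;> simp [S, hs0]
  · simp [S]

/-! ### Leaves lie in complex flow lines -/

theorem continuous_resonantField (m : ℕ) : Continuous (resonantField m) := by
  refine (PiLp.continuous_toLp 2 _).comp (continuous_pi fun i => ?_)
  fin_cases i
  · change Continuous fun z : EuclideanSpace ℂ (Fin 2) => (m : ℂ) * z 0 + z 1 ^ m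
    fun_prop
  · change Continuous fun z : EuclideanSpace ℂ (Fin 2) => z 1
    fun_prop

/-- A leaf of the trace foliation is contained in a single complex flow line. -/
theorem exists_eq_resonantFlow_of_mem_traceLeaf {m : ℕ} (hm : 1 ≤ m) {p q : UnitSphere 2}
    (hq : q ∈ traceLeaf (resonantField m) p) :
    ∃ T : ℂ, (q : EuclideanSpace ℂ (Fin 2)) = resonantFlow m p T := by
  obtain ⟨γ, hγ, hn, ht, h0, h1⟩ := hq
  have hθ : ∀ t, resonantField m (γ t) ≠ 0 := fun t h => by
    have := resonantField_transverse m hm ⟨γ t, mem_sphere_zero_iff_norm.2 (hn t)⟩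
    simp [h] at this
  -- The coefficient of `γ'` along the field, written with inner products so that its continuity is
  -- evident. Its integral `C` is the complex time elapsed along the curve.
  let c : ℝ → ℂ := fun t =>
    ⟪resonantField m (γ t), deriv γ t⟫_ℂ / ⟪resonantField m (γ t), resonantField m (γ t)⟫_ℂ
  have hθc : Continuous fun t => resonantField m (γ t) :=
    (continuous_resonantField m).comp hγ.continuous
  have hc : Continuous c := (hθc.inner (hγ.continuous_deriv le_rfl)).div (hθc.inner hθc)
    fun t => inner_self_ne_zero.2 (hθ t)
  have hcd : ∀ t, deriv γ t = c t • resonantField m (γ t) := fun t => by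
    obtain ⟨⟨k, hk⟩, -⟩ := ht t
    have : c t = k := by
      simp only [c]
      rw [hk, inner_smul_right, mul_div_cancel_right₀ _ (inner_self_ne_zero.2 (hθ t))]
    rw [this, hk]
  let C : ℝ → ℂ := fun t => ∫ r in (0 : ℝ)..t, c r
  have hC : ∀ t, HasDerivAt C (c t) t := fun t => (hc.integral_hasStrictDerivAt 0 t).hasDerivAt
  have hC0 : C 0 = 0 := intervalIntegral.integral_same
  have hcoord : ∀ (i : Fin 2) t,
      HasDerivAt (fun t => γ t i) (c t * resonantField m (γ t) i) t := fun i t => by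
    have h2 := (hγ.differentiable one_ne_zero t).hasDerivAt
    rw [hcd] at h2
    exact ((EuclideanSpace.proj i : EuclideanSpace ℂ (Fin 2) →L[ℂ] ℂ).restrictScalars
      ℝ).hasFDerivAt.comp_hasDerivAt t h2
  have hexp : ∀ (k : ℂ) t, HasDerivAt (fun t => Complex.exp (-(k * C t)))
      (Complex.exp (-(k * C t)) * -(k * c t)) t := fun k t => ((hC t).const_mul k).neg.cexp
  have hy : ∀ t, γ t 1 = γ 0 1 * Complex.exp (C t) := fun t => by
    have hd : ∀ t, HasDerivAt (fun t => γ t 1 * Complex.exp (-(1 * C t))) 0 t := fun t => by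
      refine ((hcoord 1 t).mul (hexp 1 t)).congr_deriv ?_
      rw [resonantField_apply_one]
      ring
    have := is_const_of_deriv_eq_zero (fun t => (hd t).differentiableAt) (fun t => (hd t).deriv) t 0
    simp only [hC0, one_mul, neg_zero, Complex.exp_zero, mul_one] at this
    rw [← this, mul_assoc, ← Complex.exp_add, neg_add_cancel, Complex.exp_zero, mul_one]
  have hx : ∀ t, γ t 0 = Complex.exp (m * C t) * (γ 0 0 + C t * γ 0 1 ^ m) := fun t => by
    -- Variation of constants: `x e^{-mC} - C y(0)^m` is conserved, since `y^m = y(0)^m e^{mC}`.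
    have hd : ∀ t, HasDerivAt
        (fun t => γ t 0 * Complex.exp (-(m * C t)) - C t * γ 0 1 ^ m) 0 t := fun t => by
      refine (((hcoord 0 t).mul (hexp m t)).sub ((hC t).mul_const _)).congr_deriv ?_
      have he : Complex.exp (m * C t) * Complex.exp (-(m * C t)) = 1 := by
        rw [← Complex.exp_add, add_neg_cancel, Complex.exp_zero]
      rw [resonantField_apply_zero, hy t, mul_pow, ← Complex.exp_nat_mul]
      linear_combination (c t * γ 0 1 ^ m) * he
    have := is_const_of_deriv_eq_zero (fun t => (hd t).differentiableAt) (fun t => (hd t).deriv) t 0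
    simp only [hC0, mul_zero, neg_zero, Complex.exp_zero, mul_one, zero_mul, sub_zero] at this
    have he : Complex.exp (m * C t) * Complex.exp (-(m * C t)) = 1 := by
      rw [← Complex.exp_add, add_neg_cancel, Complex.exp_zero]
    linear_combination Complex.exp (m * C t) * this - γ t 0 * he
  refine ⟨C 1, ?_⟩
  rw [← h0, ← h1]
  ext i
  fin_cases i
  · exact hx 1
  · exact hy 1

theorem traceLeaf_apply_one_eq_zero_iff {m : ℕ} (hm : 1 ≤ m) {p q : UnitSphere 2}
    (hq : q ∈ traceLeaf (resonantField m) p) : q.1 1 = 0 ↔ p.1 1 = 0 := by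
  obtain ⟨T, hT⟩ := exists_eq_resonantFlow_of_mem_traceLeaf hm hq
  rw [hT]
  simp

theorem norm_apply_le_one (p : UnitSphere 2) (i : Fin 2) : ‖p.1 i‖ ≤ 1 :=
  (PiLp.norm_apply_le p.1 i).trans_eq (mem_sphere_zero_iff_norm.1 p.2)

theorem norm_sq_add_norm_sq (p : UnitSphere 2) : ‖p.1 0‖ ^ 2 + ‖p.1 1‖ ^ 2 = 1 := by
  rw [← norm_sq_eq_add, mem_sphere_zero_iff_norm.1 p.2, one_pow]

/-! ### The first integral and the closed leaf -/

/-- Off the axis `y = 0`, the multivalued function `x / y ^ m - log y` is a first integral; this is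
its (single-valued) real part. -/
noncomputable def leafHeight (m : ℕ) (w : EuclideanSpace ℂ (Fin 2)) : ℝ :=
  (w 0 / w 1 ^ m).re - Real.log ‖w 1‖

/-- The flow translates `x / y^m` by the complex time. Imaginary time thus prescribes the imaginary
part of this quotient on a leaf. -/
theorem resonantFlow_slope {m : ℕ} {w : EuclideanSpace ℂ (Fin 2)} (hw : w 1 ≠ 0) (T : ℂ) :
    resonantFlow m w T 0 / resonantFlow m w T 1 ^ m = w 0 / w 1 ^ m + T := by
  have := pow_ne_zero m hw
  have := Complex.exp_ne_zero (m * T)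
  rw [resonantFlow_apply_zero, resonantFlow_apply_one, mul_pow, ← Complex.exp_nat_mul]
  field_simp

theorem leafHeight_resonantFlow {m : ℕ} {w : EuclideanSpace ℂ (Fin 2)} (hw : w 1 ≠ 0) (T : ℂ) :
    leafHeight m (resonantFlow m w T) = leafHeight m w := by
  rw [leafHeight, resonantFlow_slope hw, leafHeight, resonantFlow_apply_one, norm_mul,
    Real.log_mul (norm_ne_zero_iff.2 hw) (norm_ne_zero_iff.2 (Complex.exp_ne_zero _)),
    Complex.norm_exp, Real.log_exp, Complex.add_re]
  ring

theorem isClosed_traceLeaf_of_eq_zero {m : ℕ} (hm : 1 ≤ m) {p : UnitSphere 2} (hp : p.1 1 = 0) :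
    IsClosed (traceLeaf (resonantField m) p) := by
  have hm0 : m ≠ 0 := by omega
  have hset : traceLeaf (resonantField m) p = {q : UnitSphere 2 | q.1 1 = 0} := by
    ext q
    refine ⟨fun hq => (traceLeaf_apply_one_eq_zero_iff hm hq).2 hp, fun hq => ?_⟩
    have hnorm : ∀ r : UnitSphere 2, r.1 1 = 0 → ‖r.1 0‖ = 1 := fun r hr => by
      have := norm_sq_add_norm_sq r
      rw [hr, norm_zero, zero_pow two_ne_zero, add_zero] at this
      exact (pow_eq_one_iff_of_nonneg (norm_nonneg _) two_ne_zero).1 this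
    have hp0 : p.1 0 ≠ 0 := norm_ne_zero_iff.1 (by rw [hnorm p hp]; exact one_ne_zero)
    have hratio : ‖q.1 0 / p.1 0‖ = 1 := by rw [norm_div, hnorm p hp, hnorm q hq, div_one]
    obtain ⟨α, hα⟩ := (Complex.norm_eq_one_iff _).1 hratio
    -- On the axis the flow multiplies `x` by `e^{mT}`, so a rotation by `α` takes imaginary time `α
    -- / m`.
    obtain ⟨s, q', hq', hs⟩ := exists_mem_traceLeaf_eq_resonantFlow hm p (α / m)
    have h1 : q'.1 1 = 0 := (traceLeaf_apply_one_eq_zero_iff hm hq').2 hp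
    have h0 : q'.1 0 = Complex.exp (m * (s + (α / m : ℝ) * Complex.I)) * p.1 0 := by
      rw [hs, resonantFlow_apply_zero, hp]
      simp [hm0]
    have hs0 : Real.exp s = 1 := by
      have := hnorm q' h1
      rw [h0, norm_mul, norm_exp_nat_mul_ofReal_add_mul_I, hnorm p hp, mul_one] at this
      exact (pow_eq_one_iff_of_nonneg (Real.exp_pos s).le hm0).1 this
    rw [Real.exp_eq_one_iff] at hs0
    have hqq : q' = q := by
      apply Subtype.ext
      ext i
      fin_cases i
      · change q'.1 0 = q.1 0
        have hmc : (m : ℂ) ≠ 0 := Nat.cast_ne_zero.2 hm0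
        have he : (m : ℂ) * ((0 : ℝ) + (α / m : ℝ) * Complex.I) = α * Complex.I := by
          push_cast
          field_simp
          ring
        rw [h0, hs0, he, hα, div_mul_cancel₀ _ hp0]
      · exact h1.trans (Set.mem_ofPred.1 hq).symm
    exact hqq ▸ hq'
  rw [hset]
  exact isClosed_singleton.preimage (f := fun q : UnitSphere 2 => q.1 1) (by fun_prop)

/-- A closed leaf would be compact, so `|y| ≥ δ > 0` and `|x / y^m| ≤ δ^{-m}` on it; but the
imaginary part of `x / y^m` takes every real value along the leaf. -/
theorem not_isClosed_traceLeaf_of_ne_zero {m : ℕ} (hm : 1 ≤ m) {p : UnitSphere 2}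
    (hp : p.1 1 ≠ 0) : ¬ IsClosed (traceLeaf (resonantField m) p) := by
  intro hcl
  obtain ⟨δ, hδ, hmin⟩ := hcl.isCompact.exists_forall_le' (f := fun q : UnitSphere 2 => ‖q.1 1‖)
    (by fun_prop) (a := 0)
    (fun q hq => norm_pos_iff.2 (mt (traceLeaf_apply_one_eq_zero_iff hm hq).1 hp))
  obtain ⟨n, hn⟩ := exists_nat_gt (δ ^ m)⁻¹
  obtain ⟨s, q, hq, hs⟩ := exists_mem_traceLeaf_eq_resonantFlow hm p (n - (p.1 0 / p.1 1 ^ m).im)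
  have hq1 : q.1 1 ≠ 0 := mt (traceLeaf_apply_one_eq_zero_iff hm hq).1 hp
  have him : (q.1 0 / q.1 1 ^ m).im = n := by
    rw [hs, resonantFlow_slope hp]
    simp
  have h1 : (n : ℝ) ≤ ‖q.1 0 / q.1 1 ^ m‖ := him ▸ Complex.im_le_norm _
  rw [norm_div, norm_pow, le_div_iff₀ (by positivity)] at h1
  have h2 : δ ^ m ≤ ‖q.1 1‖ ^ m := pow_le_pow_left₀ hδ.le (hmin q hq) m
  have h3 : 1 < n * δ ^ m := by rwa [inv_lt_iff_one_lt_mul₀ (by positivity)] at hn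
  have h4 : n * δ ^ m ≤ n * ‖q.1 1‖ ^ m := by gcongr
  linarith [norm_apply_le_one q 0]

/-! ### Leaves near the axis -/

/-- Otherwise `|x| ≤ |y|^m (-log |y|) ≤ 1/2`, and the point would lie strictly inside the sphere. -/
theorem neg_log_norm_lt_norm_slope {m : ℕ} (hm : 1 ≤ m) {q : UnitSphere 2} (hq : q.1 1 ≠ 0)
    (hlt : ‖q.1 1‖ < 1 / 2) : -Real.log ‖q.1 1‖ < ‖q.1 0 / q.1 1 ^ m‖ := by
  by_contra! hle
  have hpos : 0 < ‖q.1 1‖ := norm_pos_iff.2 hq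
  have hx : ‖q.1 0‖ = ‖q.1 0 / q.1 1 ^ m‖ * ‖q.1 1‖ ^ m := by
    rw [norm_div, norm_pow, div_mul_cancel₀ _ (by positivity)]
  have hpw : ‖q.1 1‖ ^ m ≤ ‖q.1 1‖ := pow_le_of_le_one hpos.le (by linarith) (by omega)
  have hlog : -Real.log ‖q.1 1‖ ≤ ‖q.1 1‖⁻¹ / 2 := by
    -- The bound `e^u ≥ 1 + u` at `u = -log (2|y|)`; `log 2 < 1` discards the constants.
    have h1 := Real.add_one_le_exp (-Real.log ‖q.1 1‖ - Real.log 2)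
    rw [Real.exp_sub, Real.exp_neg, Real.exp_log hpos, Real.exp_log two_pos] at h1
    linarith [Real.log_two_lt_d9]
  have hx2 : ‖q.1 0‖ ≤ 1 / 2 := by
    rw [hx]
    calc _ ≤ ‖q.1 1‖⁻¹ / 2 * ‖q.1 1‖ := by gcongr; exact hle.trans hlog
      _ = 1 / 2 := by field_simp
  nlinarith [norm_sq_add_norm_sq q, norm_nonneg (q.1 0)]

/-- The real part of the first integral does not vanish on leaves near the axis `y = 0`. -/
theorem leafHeight_ne_zero {m : ℕ} (hm : 1 ≤ m) {p : UnitSphere 2} (hp : p.1 1 ≠ 0)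
    (hleaf : ∀ q ∈ traceLeaf (resonantField m) p, ‖q.1 1‖ < 1 / 2) : leafHeight m p.1 ≠ 0 := by
  intro h0
  -- The leaf point where `x / y^m` is real. Zero height would make it equal to `log |y| < 0`,
  -- against `neg_log_norm_lt_norm_slope`.
  obtain ⟨s, q, hq, hs⟩ := exists_mem_traceLeaf_eq_resonantFlow hm p (-(p.1 0 / p.1 1 ^ m).im)
  have hq1 : q.1 1 ≠ 0 := mt (traceLeaf_apply_one_eq_zero_iff hm hq).1 hp
  have hlt := hleaf q hq
  have him : (q.1 0 / q.1 1 ^ m).im = 0 := by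
    rw [hs, resonantFlow_slope hp]
    simp
  have hh : leafHeight m q.1 = 0 := by rw [hs, leafHeight_resonantFlow hp, h0]
  set z := q.1 0 / q.1 1 ^ m with hz
  have hre : z.re = Real.log ‖q.1 1‖ := sub_eq_zero.1 hh
  have hneg : z.re < 0 := hre ▸ Real.log_neg (norm_pos_iff.2 hq1) (by linarith)
  have hzn : ‖z‖ = -Real.log ‖q.1 1‖ := by
    rw [← Complex.abs_re_eq_norm.2 him, hre, abs_of_neg (hre ▸ hneg)]
  exact (neg_log_norm_lt_norm_slope hm hq1 hlt).ne' hzn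

/-- Leaves of large height stay close to the axis `y = 0`. -/
theorem norm_apply_one_lt_of_lt_leafHeight {m : ℕ} (hm : 1 ≤ m) {p q : UnitSphere 2}
    (hp : p.1 1 ≠ 0) (hq : q ∈ traceLeaf (resonantField m) p) {δ : ℝ} (hδ : 0 < δ)
    (h : (δ ^ m)⁻¹ - Real.log δ < leafHeight m p.1) : ‖q.1 1‖ < δ := by
  obtain ⟨T, hT⟩ := exists_eq_resonantFlow_of_mem_traceLeaf hm hq
  have hq1 : q.1 1 ≠ 0 := mt (traceLeaf_apply_one_eq_zero_iff hm hq).1 hp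
  rw [← leafHeight_resonantFlow hp T, ← hT] at h
  -- On the sphere, `|y| ≥ δ` forces height at most `δ^{-m} - log δ`.
  by_contra! hle
  have h1 : Real.log δ ≤ Real.log ‖q.1 1‖ := Real.log_le_log hδ hle
  have h2 := Complex.re_le_norm (q.1 0 / q.1 1 ^ m)
  have h3 : ‖q.1 0 / q.1 1 ^ m‖ ≤ (δ ^ m)⁻¹ := by
    rw [norm_div, norm_pow, ← one_div]
    exact div_le_div₀ zero_le_one (norm_apply_le_one q 0) (by positivity)
      (pow_le_pow_left₀ hδ.le hle m)
  rw [leafHeight] at h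
  linarith

/-- If `x / y^m` were a nonpositive real, positive height would read `|x / y^m| < -log |y|`. -/
theorem mem_slitPlane_of_leafHeight_pos {m : ℕ} (hm : 1 ≤ m) {p : UnitSphere 2} (hp : p.1 1 ≠ 0)
    (hlt : ‖p.1 1‖ < 1 / 2) (h : 0 < leafHeight m p.1) : p.1 0 / p.1 1 ^ m ∈ Complex.slitPlane := by
  by_contra hns
  rw [Complex.mem_slitPlane_iff, not_or, not_lt, not_not] at hns
  have hzn := neg_log_norm_lt_norm_slope hm hp hlt
  rw [← Complex.abs_re_eq_norm.2 hns.2, abs_of_nonpos hns.1] at hzn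
  rw [leafHeight] at h
  linarith

theorem neg_mem_slitPlane_of_leafHeight_neg {m : ℕ} {p : UnitSphere 2}
    (h : leafHeight m p.1 < 0) : -(p.1 0 / p.1 1 ^ m) ∈ Complex.slitPlane := by
  rw [leafHeight] at h
  refine Complex.mem_slitPlane_iff.2 (Or.inl ?_)
  have := Real.log_nonpos (norm_nonneg _) (norm_apply_le_one p 1)
  rw [Complex.neg_re]
  linarith

/-- Near the axis `y = 0`, a loop of leaves winds `m` times more in `x` than in `y`. -/
theorem hasWinding_of_leafHeight_ne_zero {m : ℕ} (hm : 1 ≤ m) {w : ℝ → UnitSphere 2}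
    (hw : Continuous w) (hp : ∀ t, w (t + 2 * Real.pi) = w t) (h1 : ∀ t, (w t).1 1 ≠ 0)
    (hlt : ∀ t, ‖(w t).1 1‖ < 1 / 2) (hh : ∀ t, leafHeight m (w t).1 ≠ 0) :
    ∃ k : ℤ, HasWinding (fun t => (w t).1 0) (m * k) := by
  have hc0 : Continuous fun t => (w t).1 0 := by fun_prop
  have hc1 : Continuous fun t => (w t).1 1 := by fun_prop
  have hz : Continuous fun t => (w t).1 0 / (w t).1 1 ^ m :=
    hc0.div (hc1.pow m) fun t => pow_ne_zero m (h1 t)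
  have hheight : Continuous fun t => leafHeight m (w t).1 :=
    (Complex.continuous_re.comp hz).sub (hc1.norm.log fun t => norm_ne_zero_iff.2 (h1 t))
  have hzp : ∀ t, (w (t + 2 * Real.pi)).1 0 / (w (t + 2 * Real.pi)).1 1 ^ m =
    (w t).1 0 / (w t).1 1 ^ m := fun t => by rw [hp]
  have hz0 : HasWinding (fun t => (w t).1 0 / (w t).1 1 ^ m) 0 := by
    by_cases hpos : ∀ t, 0 < leafHeight m (w t).1
    · exact hasWinding_zero_of_mem_slitPlane hz hzp fun t =>
        mem_slitPlane_of_leafHeight_pos hm (h1 t) (hlt t) (hpos t)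
    · push Not at hpos
      obtain ⟨a, ha⟩ := hpos
      refine hasWinding_zero_of_neg_mem_slitPlane hz hzp fun t =>
        neg_mem_slitPlane_of_leafHeight_neg ?_
      -- A continuous height without zeros keeps one sign along the loop.
      by_contra! hle
      obtain ⟨r, hr⟩ := mem_range_of_exists_le_of_exists_ge hheight ⟨a, ha⟩ ⟨t, hle⟩
      exact hh r hr
  obtain ⟨k, hk⟩ := exists_hasWinding hc1 h1 fun t => by rw [hp]
  refine ⟨k, ?_⟩
  have := hz0.mul (hk.pow m)
  rw [zero_add] at this
  simpa only [div_mul_cancel₀ _ (pow_ne_zero m (h1 _))] using this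

/-! ### Invariance of the closed leaf -/

theorem mem_traceLeaf_self {n : ℕ} (θ : EuclideanSpace ℂ (Fin n) → EuclideanSpace ℂ (Fin n))
    (p : UnitSphere n) : p ∈ traceLeaf θ p :=
  ⟨fun _ => p, contDiff_const, fun _ => mem_sphere_zero_iff_norm.1 p.2,
    fun t => by rw [deriv_const]; exact zero_mem _, rfl, rfl⟩

theorem TraceFoliationsEquivalent.symm {n : ℕ}
    {θ η : EuclideanSpace ℂ (Fin n) → EuclideanSpace ℂ (Fin n)} {φ : UnitSphere n ≃ₜ UnitSphere n}
    (h : ∀ p, φ '' traceLeaf θ p = traceLeaf η (φ p)) (p : UnitSphere n) :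
    φ.symm '' traceLeaf η p = traceLeaf θ (φ.symm p) := by
  have := h (φ.symm p)
  rw [φ.apply_symm_apply] at this
  rw [← this, Set.image_image]
  simp

theorem apply_one_eq_zero_of_leaf_homeomorph {m₁ m₂ : ℕ} (h₁ : 1 ≤ m₁) (h₂ : 1 ≤ m₂)
    {φ : UnitSphere 2 ≃ₜ UnitSphere 2}
    (h : ∀ p, φ '' traceLeaf (resonantField m₁) p = traceLeaf (resonantField m₂) (φ p))
    {p : UnitSphere 2} (hp : p.1 1 = 0) : (φ p).1 1 = 0 := by
  by_contra hne
  apply not_isClosed_traceLeaf_of_ne_zero h₂ hne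
  rw [← h]
  exact φ.isClosedMap _ (isClosed_traceLeaf_of_eq_zero h₁ hp)

/-! ### Test loops around the closed leaf -/

/-- The closed leaf `y = 0`, parametrized by the circle. -/
noncomputable def axisPoint (z : Circle) : UnitSphere 2 :=
  ⟨!₂[(z : ℂ), 0], mem_sphere_zero_iff_norm.2 (by
    rw [← pow_eq_one_iff_of_nonneg (norm_nonneg _) two_ne_zero, norm_sq_eq_add]
    change ‖(z : ℂ)‖ ^ 2 + ‖(0 : ℂ)‖ ^ 2 = 1
    simp only [Circle.norm_coe, norm_zero]
    norm_num)⟩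

theorem axisPoint_apply_one (z : Circle) : (axisPoint z).1 1 = 0 := rfl

theorem continuous_axisPoint : Continuous axisPoint := by
  refine Continuous.subtype_mk ((PiLp.continuous_toLp 2 _).comp (continuous_pi fun i => ?_)) _
  fin_cases i
  · exact continuous_subtype_val
  · exact continuous_const

/-- The loop in the sphere at distance `sin a` from the axis `y = 0` that runs `m` times along it
while turning once around it. -/
noncomputable def torusLoop (m : ℕ) (a t : ℝ) : UnitSphere 2 :=
  ⟨!₂[Real.cos a * Complex.exp (t * Complex.I) ^ m, Real.sin a * Complex.exp (t * Complex.I)],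
    mem_sphere_zero_iff_norm.2 (by
      rw [← pow_eq_one_iff_of_nonneg (norm_nonneg _) two_ne_zero, norm_sq_eq_add]
      simp [Complex.norm_exp, -Complex.ofReal_cos, -Complex.ofReal_sin])⟩

theorem continuous_torusLoop (m : ℕ) (a : ℝ) : Continuous (torusLoop m a) := by
  refine Continuous.subtype_mk ((PiLp.continuous_toLp 2 _).comp (continuous_pi fun i => ?_)) _
  fin_cases i
  · change Continuous fun t : ℝ => (Real.cos a * Complex.exp (t * Complex.I) ^ m : ℂ)
    fun_prop
  · change Continuous fun t : ℝ => (Real.sin a * Complex.exp (t * Complex.I) : ℂ)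
    fun_prop

theorem torusLoop_periodic (m : ℕ) (a t : ℝ) : torusLoop m a (t + 2 * Real.pi) = torusLoop m a t := by
  have : Complex.exp ((t + 2 * Real.pi : ℝ) * Complex.I) = Complex.exp (t * Complex.I) := by
    push_cast
    exact Complex.exp_mul_I_periodic t
  simp only [torusLoop, this]

theorem torusLoop_zero (m : ℕ) (t : ℝ) : torusLoop m 0 t = axisPoint (Circle.exp (m * t)) := by
  apply Subtype.ext
  ext i
  fin_cases i
  · simp [torusLoop, axisPoint, ← Complex.exp_nat_mul]
  · simp [torusLoop, axisPoint]

theorem dist_torusLoop_zero_le (m : ℕ) {a : ℝ} (ha : 0 ≤ a) (t : ℝ) :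
    dist (torusLoop m a t) (torusLoop m 0 t) ≤ a := by
  rw [Subtype.dist_eq, dist_eq_norm, ← sq_le_sq₀ (norm_nonneg _) ha, norm_sq_eq_add]
  have h0 : ((torusLoop m a t).1 - (torusLoop m 0 t).1) 0 =
      ((Real.cos a - 1 : ℝ) : ℂ) * Complex.exp (t * Complex.I) ^ m := by
    change (Real.cos a * Complex.exp (t * Complex.I) ^ m -
      Real.cos 0 * Complex.exp (t * Complex.I) ^ m : ℂ) = _
    rw [Real.cos_zero, ← sub_mul, Complex.ofReal_sub]
  have h1 : ((torusLoop m a t).1 - (torusLoop m 0 t).1) 1 =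
      (Real.sin a : ℂ) * Complex.exp (t * Complex.I) := by
    change (Real.sin a * Complex.exp (t * Complex.I) -
      Real.sin 0 * Complex.exp (t * Complex.I) : ℂ) = _
    rw [Real.sin_zero, Complex.ofReal_zero, zero_mul, sub_zero]
  rw [h0, h1, norm_mul, norm_mul, norm_pow, Complex.norm_exp_ofReal_mul_I, one_pow, mul_one,
    mul_one, Complex.norm_real, Complex.norm_real, Real.norm_eq_abs, Real.norm_eq_abs, sq_abs,
    sq_abs]
  -- The squared distance is `2 - 2 cos a ≤ a²`.
  nlinarith [Real.sin_sq_add_cos_sq a, Real.one_sub_sq_div_two_le_cos (x := a)]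

theorem torusLoop_apply_one_ne_zero (m : ℕ) {a : ℝ} (ha : 0 < a) (ha1 : a ≤ 1) (t : ℝ) :
    (torusLoop m a t).1 1 ≠ 0 :=
  mul_ne_zero (Complex.ofReal_ne_zero.2
    (Real.sin_pos_of_pos_of_lt_pi ha (by linarith [Real.pi_gt_three])).ne') (Complex.exp_ne_zero _)

/-- The factors `e^{imt}` cancel, so `x / y^m` is a positive real constant and only `-log (sin a)`
has to be estimated. -/
theorem neg_log_le_leafHeight_torusLoop (m : ℕ) {a : ℝ} (ha : 0 < a) (ha1 : a ≤ 1) (t : ℝ) :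
    -Real.log a ≤ leafHeight m (torusLoop m a t).1 := by
  have hs := Real.sin_pos_of_pos_of_lt_pi ha (by linarith [Real.pi_gt_three])
  have hc := Real.cos_pos_of_mem_Ioo (x := a)
    ⟨by linarith [Real.pi_gt_three], by linarith [Real.pi_gt_three]⟩
  have h0 : (torusLoop m a t).1 0 = Real.cos a * Complex.exp (t * Complex.I) ^ m := rfl
  have h1 : (torusLoop m a t).1 1 = Real.sin a * Complex.exp (t * Complex.I) := rfl
  have hz : (torusLoop m a t).1 0 / (torusLoop m a t).1 1 ^ m =
      ((Real.cos a / Real.sin a ^ m : ℝ) : ℂ) := by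
    rw [h0, h1, mul_pow, mul_div_mul_right _ _ (pow_ne_zero m (Complex.exp_ne_zero _)),
      Complex.ofReal_div, Complex.ofReal_pow]
  have hn : ‖(torusLoop m a t).1 1‖ = Real.sin a := by
    rw [h1, norm_mul, Complex.norm_exp_ofReal_mul_I, mul_one, Complex.norm_real,
      Real.norm_of_nonneg hs.le]
  rw [leafHeight, hz, hn, Complex.ofReal_re]
  have := Real.log_le_log hs (Real.sin_le ha.le)
  have : 0 < Real.cos a / Real.sin a ^ m := by positivity
  linarith

theorem HasWinding.comp_nat_mul {f : ℝ → ℂ} {d : ℤ} (hf : HasWinding f d) (m : ℕ) :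
    HasWinding (fun t => f (m * t)) (m * d) := by
  obtain ⟨g, hg, hfg, hgd⟩ := hf
  have hk : ∀ (k : ℕ) (s : ℝ), g (s + k * (2 * Real.pi)) = g s + 2 * Real.pi * Complex.I * (k * d) := by
    intro k
    induction k with
    | zero => simp
    | succ k ih =>
      intro s
      have : s + ((k + 1 : ℕ) : ℝ) * (2 * Real.pi) = (s + k * (2 * Real.pi)) + 2 * Real.pi := by
        push_cast; ring
      rw [this, hgd, ih]
      push_cast
      ring
  refine ⟨fun t => g (m * t), by fun_prop, fun t => hfg _, fun t => ?_⟩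
  have := hk m (m * t)
  push_cast
  rw [← this]
  congr 1
  ring

theorem continuous_apply_coord (i : Fin 2) : Continuous fun p : UnitSphere 2 => p.1 i := by
  fun_prop

theorem exists_pos_lt_and_lt_neg_log {ρ : ℝ} (hρ : 0 < ρ) (M : ℝ) :
    ∃ a : ℝ, 0 < a ∧ a ≤ 1 ∧ a < ρ ∧ M < -Real.log a := by
  have hb : 0 < Real.exp (-M) := Real.exp_pos _
  have ha : 0 < min 1 (min (ρ / 2) (Real.exp (-M) / 2)) := by positivity
  have e1 := (min_le_right 1 _).trans (min_le_left (ρ / 2) (Real.exp (-M) / 2))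
  have e2 := (min_le_right 1 _).trans (min_le_right (ρ / 2) (Real.exp (-M) / 2))
  refine ⟨_, ha, min_le_left _ _, by linarith, ?_⟩
  have := Real.log_lt_log ha (e2.trans_lt (half_lt_self hb))
  rw [Real.log_exp] at this
  linarith

/-- By compactness, points close enough to the axis are mapped uniformly close to it; the statement
is the contrapositive. -/
theorem exists_pos_forall_le_norm_apply_one {φ : UnitSphere 2 → UnitSphere 2} (hφ : Continuous φ)
    (h : ∀ p : UnitSphere 2, p.1 1 = 0 → (φ p).1 1 = 0) {ε : ℝ} (hε : 0 < ε) :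
    ∃ δ > 0, ∀ p : UnitSphere 2, ε ≤ ‖(φ p).1 1‖ → δ ≤ ‖p.1 1‖ := by
  have hcl : IsClosed {p : UnitSphere 2 | ε ≤ ‖(φ p).1 1‖} :=
    isClosed_le continuous_const ((continuous_apply_coord 1).comp hφ).norm
  obtain ⟨δ, hδ, hmin⟩ := hcl.isCompact.exists_forall_le' (f := fun p : UnitSphere 2 => ‖p.1 1‖)
    (continuous_apply_coord 1).norm.continuousOn (a := 0) (fun p hp => by
      refine norm_pos_iff.2 fun h0 => ?_
      rw [Set.mem_ofPred, h p h0, norm_zero] at hp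
      exact hp.not_gt hε)
  exact ⟨δ, hδ, fun p hp => hmin p hp⟩

theorem norm_apply_zero_eq_one {p : UnitSphere 2} (hp : p.1 1 = 0) : ‖p.1 0‖ = 1 := by
  have hn := norm_sq_add_norm_sq p
  rw [hp, norm_zero, zero_pow two_ne_zero, add_zero] at hn
  exact (pow_eq_one_iff_of_nonneg (norm_nonneg _) two_ne_zero).1 hn

/-! ### Degree on the closed leaf and divisibility -/

/-- If `d` is the degree of a leaf-preserving homeomorphism on the closed leaf, then `m₂ ∣ m₁ d`. -/
theorem dvd_mul_degree {m₁ m₂ : ℕ} (h₁ : 1 ≤ m₁) (h₂ : 1 ≤ m₂) {φ : UnitSphere 2 ≃ₜ UnitSphere 2}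
    (h : ∀ p, φ '' traceLeaf (resonantField m₁) p = traceLeaf (resonantField m₂) (φ p)) {d : ℤ}
    (hd : HasWinding (fun t => (φ (axisPoint (Circle.exp t))).1 0) d) : (m₂ : ℤ) ∣ m₁ * d := by
  have hoff : ∀ {p : UnitSphere 2}, p.1 1 ≠ 0 → (φ p).1 1 ≠ 0 := fun {p} hp hφ => hp <| by
    have := apply_one_eq_zero_of_leaf_homeomorph h₂ h₁ (TraceFoliationsEquivalent.symm h) hφ
    rwa [φ.symm_apply_apply] at this
  obtain ⟨δ, hδ, hmin⟩ := exists_pos_forall_le_norm_apply_one φ.continuous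
    (fun p hp => apply_one_eq_zero_of_leaf_homeomorph h₁ h₂ h hp) (one_half_pos (α := ℝ))
  have huc : UniformContinuous fun p : UnitSphere 2 => (φ p).1 0 :=
    CompactSpace.uniformContinuous_of_continuous ((continuous_apply_coord 0).comp φ.continuous)
  obtain ⟨ρ, hρ, hclose⟩ := Metric.uniformContinuous_iff.1 huc 1 one_pos
  -- Small `a` serves twice: `a < ρ` keeps the image loop within 1 of the image of the axis loop,
  -- and the large height keeps whole leaves in `|y| < δ`, so that their images lie in `|y| < 1/2`.
  obtain ⟨a, ha, ha1, haρ, hah⟩ := exists_pos_lt_and_lt_neg_log hρ ((δ ^ m₁)⁻¹ - Real.log δ)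
  have hc : Continuous fun t => φ (torusLoop m₁ a t) :=
    φ.continuous.comp (continuous_torusLoop m₁ a)
  have hper : ∀ t, φ (torusLoop m₁ a (t + 2 * Real.pi)) = φ (torusLoop m₁ a t) :=
    fun t => by rw [torusLoop_periodic]
  have hne := torusLoop_apply_one_ne_zero m₁ ha ha1
  have hleaf : ∀ t, ∀ q ∈ traceLeaf (resonantField m₂) (φ (torusLoop m₁ a t)),
      ‖q.1 1‖ < 1 / 2 := fun t q hq => by
    rw [← h] at hq
    obtain ⟨p, hp, rfl⟩ := hq
    by_contra! hle
    exact (norm_apply_one_lt_of_lt_leafHeight h₁ (hne t) hp hδ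
      (hah.trans_le (neg_log_le_leafHeight_torusLoop m₁ ha ha1 t))).not_ge (hmin p hle)
  have hself : ∀ t, ‖(φ (torusLoop m₁ a t)).1 1‖ < 1 / 2 :=
    fun t => hleaf t _ (mem_traceLeaf_self _ _)
  obtain ⟨k, hk⟩ := hasWinding_of_leafHeight_ne_zero h₂ hc hper (fun t => hoff (hne t)) hself
    fun t => leafHeight_ne_zero h₂ (hoff (hne t)) (hleaf t)
  -- At `a = 0` the loop covers the closed leaf `m₁` times.
  have hw : HasWinding (fun t => (φ (torusLoop m₁ 0 t)).1 0) (m₁ * d) := by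
    simp only [torusLoop_zero]
    exact hd.comp_nat_mul m₁
  have hw' : HasWinding (fun t => (φ (torusLoop m₁ a t)).1 0) (m₁ * d) := by
    refine hw.of_norm_sub_lt ((continuous_apply_coord 0).comp hc) (fun t => by rw [hper]) fun t => ?_
    have hax : (φ (torusLoop m₁ 0 t)).1 1 = 0 :=
      apply_one_eq_zero_of_leaf_homeomorph h₁ h₂ h (by rw [torusLoop_zero, axisPoint_apply_one])
    rw [norm_apply_zero_eq_one hax, ← dist_eq_norm]
    exact hclose ((dist_torusLoop_zero_le m₁ ha.le t).trans_lt haρ)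
  exact ⟨k, hw'.unique hk⟩

/-- The self-map of the closed leaf induced by a map of the sphere that preserves it. -/
theorem exists_circle_map {φ : UnitSphere 2 → UnitSphere 2}
    (h : ∀ p : UnitSphere 2, p.1 1 = 0 → (φ p).1 1 = 0) :
    ∃ a : Circle → Circle, ∀ z, φ (axisPoint z) = axisPoint (a z) := by
  have hn : ∀ z, ‖(φ (axisPoint z)).1 0‖ = 1 := fun z =>
    norm_apply_zero_eq_one (h _ (axisPoint_apply_one z))
  refine ⟨fun z => ⟨(φ (axisPoint z)).1 0, mem_sphere_zero_iff_norm.2 (hn z)⟩, fun z => ?_⟩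
  apply Subtype.ext
  ext i
  fin_cases i
  · rfl
  · exact h _ (axisPoint_apply_one z)

theorem axisPoint_injective : Function.Injective axisPoint := fun _ _ h =>
  Circle.ext (congrArg (fun p : UnitSphere 2 => p.1 0) h)

theorem exists_degree {φ : UnitSphere 2 → UnitSphere 2} (hφ : Continuous φ)
    (h : ∀ p : UnitSphere 2, p.1 1 = 0 → (φ p).1 1 = 0) :
    ∃ d, HasWinding (fun t => (φ (axisPoint (Circle.exp t))).1 0) d := by
  have hc : Continuous fun t => φ (axisPoint (Circle.exp t)) :=
    hφ.comp (continuous_axisPoint.comp Circle.exp.continuous)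
  refine exists_hasWinding ((continuous_apply_coord 0).comp hc) (fun t h0 => ?_) fun t => ?_
  · have hn := norm_sq_add_norm_sq (φ (axisPoint (Circle.exp t)))
    rw [h _ (axisPoint_apply_one _), h0] at hn
    norm_num at hn
  · beta_reduce
    rw [Circle.periodic_exp]

theorem dvd_of_leaf_homeomorph {m₁ m₂ : ℕ} (h₁ : 1 ≤ m₁) (h₂ : 1 ≤ m₂)
    {φ : UnitSphere 2 ≃ₜ UnitSphere 2}
    (h : ∀ p, φ '' traceLeaf (resonantField m₁) p = traceLeaf (resonantField m₂) (φ p)) :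
    m₂ ∣ m₁ := by
  have hK := fun p : UnitSphere 2 => apply_one_eq_zero_of_leaf_homeomorph h₁ h₂ h (p := p)
  have hK' := fun p : UnitSphere 2 =>
    apply_one_eq_zero_of_leaf_homeomorph h₂ h₁ (TraceFoliationsEquivalent.symm h) (p := p)
  obtain ⟨d, hd⟩ := exists_degree φ.continuous hK
  obtain ⟨e, he⟩ := exists_degree φ.symm.continuous hK'
  obtain ⟨a, ha⟩ := exists_circle_map hK
  obtain ⟨b, hb⟩ := exists_circle_map hK'
  have hab : ∀ z, b (a z) = z := fun z => axisPoint_injective (by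
    rw [← hb, ← ha, φ.symm_apply_apply])
  have hdvd := dvd_mul_degree h₁ h₂ h hd
  simp only [ha] at hd
  simp only [hb] at he
  have hde : d * e = 1 := HasWinding.mul_eq_one hab hd he
  -- Multiplying by `e` removes the unit `d` from `m₂ ∣ m₁ d`.
  have := hdvd.mul_right e
  rw [mul_assoc, hde, mul_one] at this
  exact_mod_cast this

theorem mainTheorem3 (m₁ m₂ : ℕ) (h₁ : 1 ≤ m₁) (h₂ : 1 ≤ m₂) (hne : m₁ ≠ m₂) :
    ¬ TraceFoliationsEquivalent (resonantField m₁) (resonantField m₂) := by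
  rintro ⟨φ, h⟩
  exact hne (Nat.dvd_antisymm (dvd_of_leaf_homeomorph h₂ h₁ (TraceFoliationsEquivalent.symm h))
    (dvd_of_leaf_homeomorph h₁ h₂ h))
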